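/- Let $d\ge 2$. A convex body in $\mathbb{E}^d$ is a compact convex set with non-empty interior. For a convex body $\mathbf{A}$ and a hyperplane $H$ of $\mathbb{E}^d$, let $w(\mathbf{A},H)$ be the distance between the two supporting hyperplanes of $\mathbf{A}$ parallel to $H$. For convex bodies $\mathbf{A},\mathbf{C}$ the minimal $\mathbf{C}$-width of $\mathbf{A}$ is $$w_{\mathbf{C}}(\mathbf{A})=\min_H \frac{w(\mathbf{A},H)}{w(\mathbf{C},H)},$$ where the minimum is taken over all hyperplanes $H$ of $\mathbb{E}^d$. A convex partition of $\mathbb{E}^d$ is a finite family $\mathbf{V}_1,\dots,\mathbf{V}_n$ $(n\ge 1)$ of closed convex sets with pairwise disjoint non-empty interiors and $\mathbf{V}_1\cup\dots\cup\mathbf{V}_n=\mathbb{E}^d$. Inductive partitions are defined recursively in $n$: the partition into one part $\mathbf{V}_1=\mathbb{E}^d$ is inductive; for $n\ge 2$, a convex partition $\mathbf{V}_1\cup\dots\cup\mathbf{V}_n$ is inductive if for every $1\le i\le n$ there is an inductive partition $\mathbf{W}_1\cup\dots\cup\mathbf{W}_{i-1}\cup\mathbf{W}_{i+1}\cup\dots\cup\mathbf{W}_n$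 of $\mathbb{E}^d$ such that $\mathbf{V}_j\subset\mathbf{W}_j$ for all $j\ne i$. Corollary 2.3. Let $\mathbf{K}$ and $\mathbf{C}$ be convex bodies in $\mathbb{E}^d$, $d\ge 2$. If $\mathbf{V}_1\cup\dots\cup\mathbf{V}_n$ is an inductive partition of $\mathbb{E}^d$ such that ${\rm int}(\mathbf{V}_i\cap\mathbf{K})\ne\emptyset$ for all $1\le i\le n$, then $$\sum_{i=1}^n w_{\mathbf{C}}(\mathbf{V}_i\cap\mathbf{K})\ge w_{\mathbf{C}}(\mathbf{K}).$$ -/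

import Mathlib

/-- A convex partition of a space: finitely many closed convex sets with pairwise disjoint,
non-empty interiors whose union is the whole space. -/
structure IsConvexPartition {d n : ℕ} (V : Fin n → Set (EuclideanSpace ℝ (Fin d))) : Prop where
  isClosed : ∀ i, IsClosed (V i)
  convex : ∀ i, Convex ℝ (V i)
  interior_nonempty : ∀ i, (interior (V i)).Nonempty
  interior_disjoint : ∀ i j, i ≠ j → Disjoint (interior (V i)) (interior (V j))
  iUnion_eq : ⋃ i, V i = Set.univ

/-- Inductive partitions, by recursion on the number of parts. The one-part partition is inductive;
a convex partition into at least two parts is inductive if for every index `i` there is an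
inductive partition `W`, indexed by the remaining indices, with `V j ⊆ W j` for all `j ≠ i`.
The remaining indices are enumerated increasingly by `i.succAbove`. -/
def IsInductivePartition {d : ℕ} : {n : ℕ} → (Fin n → Set (EuclideanSpace ℝ (Fin d))) → Prop
  | 0, _ => False
  | 1, V => V 0 = Set.univ
  | n + 2, V => IsConvexPartition V ∧
      ∀ i : Fin (n + 2), ∃ W : Fin (n + 1) → Set (EuclideanSpace ℝ (Fin d)),
        IsInductivePartition W ∧ ∀ j : Fin (n + 1), V (i.succAbove j) ⊆ W j

/-- The width of `A` parallel to the hyperplanes with unit normal vector `u`: the distance between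
the two supporting hyperplanes `{x | ⟪u, x⟫ = sup over A}` and `{x | ⟪u, x⟫ = inf over A}`.
It is meant for unit vectors `u` and non-empty bounded sets `A`. -/
noncomputable def widthParallel {d : ℕ} (A : Set (EuclideanSpace ℝ (Fin d)))
    (u : EuclideanSpace ℝ (Fin d)) : ℝ :=
  sSup ((fun x => inner ℝ u x) '' A) - sInf ((fun x => inner ℝ u x) '' A)

/-- The minimal `C`-width of `A`: the least value of `w(A, H) / w(C, H)` over all
hyperplanes `H`, each direction of hyperplanes being given by a unit normal vector. -/
noncomputable def minimalRelativeWidth {d : ℕ} (C A : Set (EuclideanSpace ℝ (Fin d))) : ℝ :=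
  ⨅ u : Metric.sphere (0 : EuclideanSpace ℝ (Fin d)) 1, widthParallel A u / widthParallel C u

/-!
For a convex body `B`, call the largest ratio of a homothetic copy of `B` inside `A` the inradius of
`A` relative to `B`. For every inductive partition `V` and every translate `y + B`, the relative
inradii of the pieces `(y + B) ∩ V i` add up to at least `1`. Indeed, by convexity their sum is a
concave function of `y` on the closed convex set of those `y` for which `y + B` meets every part.
This set is not the whole space, so it suffices to bound the sum on its frontier: a point of the set
lies between two frontier points, or on a ray in the set that issues from a frontier point, along
which a concave function bounded below cannot decrease. For `y` on the frontier (or outside), the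
interior of `y + B` misses the interior of some part `V i`. Let `W` be an inductive partition with
`V j ⊆ W j` for `j ≠ i`. A copy of `B` inside `(y + B) ∩ W j` cannot meet the interiors of the parts
other than `V j`, so it lies in `V j`, and induction applies to `W`.

A set containing a copy of `K` of ratio `r` is at least `r` times as wide as `K` in every direction,
so the bound on the sum of inradii passes to widths.
-/

open Set Filter Topology Bornology
open scoped Pointwise

section ConcaveFrontier

variable {E : Type*} [AddCommGroup E] [Module ℝ E] {D : Set E} {F : E → ℝ} {x y z : E}

theorem le_of_concaveOn_of_forall_lineMap_mem (hF : ConcaveOn ℝ D F) (hbdd : BddBelow (F '' D))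
    (hx : x ∈ D) (hray : ∀ t : ℝ, 1 ≤ t → AffineMap.lineMap x y t ∈ D) : F x ≤ F y := by
  obtain ⟨m, hm⟩ := hbdd
  have hlim : Tendsto (fun s : ℝ => (1 - s) * F x + s * m) (𝓝[>] 0) (𝓝 (F x)) := by
    have hcont : Continuous fun s : ℝ => (1 - s) * F x + s * m := by fun_prop
    simpa using (hcont.tendsto 0).mono_left nhdsWithin_le_nhds
  refine le_of_tendsto hlim ?_
  filter_upwards [Ioc_mem_nhdsGT one_pos] with s hs
  have hq : AffineMap.lineMap x y s⁻¹ ∈ D := hray _ ((one_le_inv₀ hs.1).mpr hs.2)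
  have hy : (1 - s) • x + s • AffineMap.lineMap x y s⁻¹ = y := by
    have := hs.1.ne'
    rw [AffineMap.lineMap_apply_module]
    match_scalars <;> field_simp
    ring
  calc (1 - s) * F x + s * m
      ≤ (1 - s) * F x + s * F (AffineMap.lineMap x y s⁻¹) := by
        gcongr
        exacts [hs.1.le, hm (mem_image_of_mem F hq)]
    _ ≤ F y := by
        simpa only [hy, smul_eq_mul] using
          hF.2 hx hq (sub_nonneg.mpr hs.2) hs.1.le (sub_add_cancel 1 s)

variable [TopologicalSpace E] [IsTopologicalAddGroup E] [ContinuousSMul ℝ E]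

theorem exists_mem_frontier_wbtw (hx : x ∈ D) (hz : z ∉ D) : ∃ p ∈ frontier D, Wbtw ℝ x p z := by
  by_contra! hdisj
  have hcover : segment ℝ x z ⊆ interior D ∪ (closure D)ᶜ := fun p hp => by
    by_contra hp'
    rw [mem_union, not_or, notMem_compl_iff] at hp'
    exact hdisj p ⟨hp'.2, hp'.1⟩ (mem_segment_iff_wbtw.mp hp)
  have hxI : x ∈ interior D := (hcover (left_mem_segment ℝ x z)).resolve_right
    (not_not_intro (subset_closure hx))
  have hzC : z ∈ (closure D)ᶜ := (hcover (right_mem_segment ℝ x z)).resolve_left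
    fun h => hz (interior_subset h)
  obtain ⟨p, -, hpI, hpC⟩ := (convex_segment x z).isPreconnected _ _ isOpen_interior
    isClosed_closure.isOpen_compl hcover ⟨x, left_mem_segment ℝ x z, hxI⟩
    ⟨z, right_mem_segment ℝ x z, hzC⟩
  exact hpC (interior_subset_closure hpI)

theorem le_of_concaveOn_of_forall_mem_frontier {c : ℝ} (hD : IsClosed D) (hne : D ≠ univ)
    (hF : ConcaveOn ℝ D F) (hbdd : BddBelow (F '' D)) (hc : ∀ p ∈ frontier D, c ≤ F p)
    (hy : y ∈ D) : c ≤ F y := by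
  obtain ⟨z, hz⟩ := (ne_univ_iff_exists_notMem D).mp hne
  obtain ⟨p, hp, -⟩ := exists_mem_frontier_wbtw hy hz
  have hpD : p ∈ D := hD.frontier_subset hp
  by_cases hray : ∀ t : ℝ, 1 ≤ t → AffineMap.lineMap p y t ∈ D
  · exact (hc p hp).trans (le_of_concaveOn_of_forall_lineMap_mem hF hbdd hpD hray)
  · push Not at hray
    obtain ⟨t, ht, htD⟩ := hray
    obtain ⟨q, hq, hyq⟩ := exists_mem_frontier_wbtw hy htD
    have hpt : Wbtw ℝ p y (AffineMap.lineMap p y t) := by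
      simpa [AffineMap.lineMap_apply] using
        wbtw_smul_vadd_smul_vadd_of_nonneg_of_le p (y - p) zero_le_one ht
    have hpyq : y ∈ segment ℝ p q := mem_segment_iff_wbtw.mpr (hpt.trans_right_left hyq)
    exact (le_min (hc p hp) (hc q hq)).trans
      (hF.ge_on_segment hpD (hD.frontier_subset hq) hpyq)

end ConcaveFrontier

theorem subset_of_convex_of_interior_subset {E : Type*} [AddCommGroup E] [Module ℝ E]
    [TopologicalSpace E] [IsTopologicalAddGroup E] [ContinuousSMul ℝ E] {A V : Set E}
    (hA : Convex ℝ A) (hAi : (interior A).Nonempty) (hV : IsClosed V) (h : interior A ⊆ V) :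
    A ⊆ V :=
  calc A ⊆ closure A := subset_closure
    _ = closure (interior A) := (hA.closure_interior_eq_closure_of_nonempty_interior hAi).symm
    _ ⊆ V := closure_minimal h hV

theorem sub_ne_univ_of_convex_of_isCompact {E : Type*} [AddCommGroup E] [Module ℝ E]
    [TopologicalSpace E] [IsTopologicalAddGroup E] [ContinuousSMul ℝ E] [LocallyConvexSpace ℝ E]
    {V B : Set E} (hVc : IsClosed V) (hV : Convex ℝ V) (hne : V ≠ univ) (hB : IsCompact B) :
    V - B ≠ univ := by
  intro huniv
  obtain ⟨x, hx⟩ := (ne_univ_iff_exists_notMem V).mp hne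
  obtain ⟨f, u, hfu, hux⟩ := geometric_hahn_banach_closed_point hV hVc hx
  obtain ⟨m, hm⟩ := (hB.image f.continuous).bddBelow
  have hf : (f : E →ₗ[ℝ] ℝ) ≠ 0 := by
    rintro hf
    obtain ⟨a, ha, -⟩ := mem_sub.mp (huniv ▸ mem_univ x)
    have hfa := hfu a ha
    have hzero : ∀ z, f z = 0 := LinearMap.congr_fun hf
    rw [hzero] at hfa hux
    exact hfa.not_gt hux
  obtain ⟨y, hy⟩ := LinearMap.surjective hf (u - m)
  obtain ⟨v, hv, b, hb, rfl⟩ := mem_sub.mp (huniv ▸ mem_univ y)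
  have hfb := hm (mem_image_of_mem f hb)
  have hfv := hfu v hv
  simp only [ContinuousLinearMap.coe_coe, map_sub] at hy
  linarith

section RelativeInradius

variable {E : Type*} [AddCommGroup E] [Module ℝ E]

/-- The ratios of the homothetic copies of `B` contained in `A`. Only ratios in `[0, 1]` are
admitted, which is no restriction when `A` lies in a translate of a convex body `B` of positive
dimension and keeps the set bounded in all cases. -/
def homothetyRatios (B A : Set E) : Set ℝ :=
  {r | r ∈ Icc 0 1 ∧ ∃ x : E, x +ᵥ r • B ⊆ A}

/-- The inradius of `A` relative to `B`: the supremum of the ratios in `[0, 1]` of homothetic copies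
of `B` contained in `A`. It is `0` when there is no such copy. -/
noncomputable def relativeInradius (B A : Set E) : ℝ :=
  sSup (homothetyRatios B A)

variable {A A' A'' B V : Set E} {r s t : ℝ} {x : E}

theorem bddAbove_homothetyRatios : BddAbove (homothetyRatios B A) :=
  ⟨1, fun _ hr => hr.1.2⟩

theorem homothetyRatios_nonempty (hA : A.Nonempty) : (homothetyRatios B A).Nonempty := by
  obtain ⟨a, ha⟩ := hA
  refine ⟨0, left_mem_Icc.mpr zero_le_one, a, ?_⟩
  rintro _ ⟨_, hb, rfl⟩
  simpa [mem_zero.mp (zero_smul_set_subset B hb)] using ha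

theorem le_relativeInradius (hr : r ∈ Icc 0 1) (h : x +ᵥ r • B ⊆ A) : r ≤ relativeInradius B A :=
  le_csSup bddAbove_homothetyRatios ⟨hr, x, h⟩

theorem relativeInradius_nonneg : 0 ≤ relativeInradius B A :=
  Real.sSup_nonneg fun _ hr => hr.1.1

theorem relativeInradius_le_of_forall_pos
    (h : ∀ r > (0 : ℝ), ∀ x : E, x +ᵥ r • B ⊆ A → x +ᵥ r • B ⊆ A') :
    relativeInradius B A ≤ relativeInradius B A' := by
  refine Real.sSup_le ?_ relativeInradius_nonneg
  rintro r ⟨hr, x, hx⟩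
  rcases hr.1.eq_or_lt with rfl | hpos
  · exact relativeInradius_nonneg
  · exact le_relativeInradius hr (h r hpos x hx)

theorem relativeInradius_superadditive (hA : A.Nonempty) (hA' : A'.Nonempty) (hs : 0 ≤ s)
    (ht : 0 ≤ t) (hst : s + t = 1) (h : s • A + t • A' ⊆ A'') :
    s * relativeInradius B A + t * relativeInradius B A' ≤ relativeInradius B A'' := by
  have hsub : s • homothetyRatios B A + t • homothetyRatios B A' ⊆ homothetyRatios B A'' := by
    rintro _ ⟨_, ⟨r, ⟨hr, x, hx⟩, rfl⟩, _, ⟨r', ⟨hr', x', hx'⟩, rfl⟩, rfl⟩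
    refine ⟨convex_Icc 0 1 hr hr' hs ht hst, s • x + t • x', ?_⟩
    rintro _ ⟨_, ⟨b, hb, rfl⟩, rfl⟩
    refine h ⟨s • (x + r • b), smul_mem_smul_set (hx (vadd_mem_vadd_set (smul_mem_smul_set hb))),
      t • (x' + r' • b), smul_mem_smul_set (hx' (vadd_mem_vadd_set (smul_mem_smul_set hb))), ?_⟩
    simp only [vadd_eq_add, smul_eq_mul]
    module
  have hne : (homothetyRatios B A).Nonempty := homothetyRatios_nonempty hA
  have hne' : (homothetyRatios B A').Nonempty := homothetyRatios_nonempty hA'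
  calc s * relativeInradius B A + t * relativeInradius B A'
      = sSup (s • homothetyRatios B A) + sSup (t • homothetyRatios B A') := by
        rw [Real.sSup_smul_of_nonneg hs, Real.sSup_smul_of_nonneg ht]
        rfl
    _ = sSup (s • homothetyRatios B A + t • homothetyRatios B A') :=
        (csSup_add hne.smul_set (bddAbove_homothetyRatios.smul_of_nonneg hs) hne'.smul_set
          (bddAbove_homothetyRatios.smul_of_nonneg ht)).symm
    _ ≤ relativeInradius B A'' :=
        csSup_le_csSup bddAbove_homothetyRatios (hne.smul_set.add hne'.smul_set) hsub

theorem concaveOn_relativeInradius_vadd_inter (hB : Convex ℝ B) (hV : Convex ℝ V) :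
    ConcaveOn ℝ (V - B) fun y => relativeInradius B ((y +ᵥ B) ∩ V) := by
  have hmeet : ∀ y ∈ V - B, ((y +ᵥ B) ∩ V).Nonempty := by
    rintro _ ⟨v, hv, b, hb, rfl⟩
    exact vadd_inter_nonempty_iff'.mpr ⟨v, b, ⟨hv, hb⟩, rfl⟩
  refine ⟨hV.sub hB, fun p hp q hq s t hs ht hst => ?_⟩
  refine relativeInradius_superadditive (hmeet p hp) (hmeet q hq) hs ht hst ?_
  rintro _ ⟨_, ⟨_, ⟨⟨b, hb, rfl⟩, hv⟩, rfl⟩, _, ⟨_, ⟨⟨b', hb', rfl⟩, hv'⟩, rfl⟩, rfl⟩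
  refine ⟨⟨s • b + t • b', hB hb hb' hs ht hst, ?_⟩, hV hv hv' hs ht hst⟩
  simp only [vadd_eq_add]
  module

end RelativeInradius

section Partition

variable {d n : ℕ} {V : Fin n → Set (EuclideanSpace ℝ (Fin d))}
  {B U : Set (EuclideanSpace ℝ (Fin d))}

namespace IsConvexPartition

theorem dense_iUnion_interior (hV : IsConvexPartition V) : Dense (⋃ i, interior (V i)) := by
  rw [dense_iff_closure_eq, closure_iUnion_of_finite, ← univ_subset_iff, ← hV.iUnion_eq]
  refine iUnion_mono fun i => ?_
  rw [(hV.convex i).closure_interior_eq_closure_of_nonempty_interior (hV.interior_nonempty i)]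
  exact subset_closure

theorem ne_univ (hV : IsConvexPartition V) {i j : Fin n} (hij : i ≠ j) : V i ≠ univ := by
  intro hi
  have hdisj := hV.interior_disjoint i j hij
  rw [hi, interior_univ, univ_disjoint] at hdisj
  exact (hV.interior_nonempty j).ne_empty hdisj

theorem subset_of_forall_disjoint_interior (hV : IsConvexPartition V) (hU : IsOpen U) {j : Fin n}
    (h : ∀ k ≠ j, Disjoint (interior (V k)) U) : U ⊆ V j := by
  by_contra hsub
  obtain ⟨p, ⟨hpU, hpj⟩, hp⟩ := hV.dense_iUnion_interior.inter_open_nonempty (U \ V j)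
    (hU.sdiff (hV.isClosed j)) (sdiff_nonempty.mpr hsub)
  obtain ⟨k, hpk⟩ := mem_iUnion.mp hp
  rcases eq_or_ne k j with rfl | hkj
  · exact hpj (interior_subset hpk)
  · exact disjoint_left.mp (h k hkj) hpk hpU

theorem relativeInradius_inter_le_of_disjoint {V : Fin (n + 1) → Set (EuclideanSpace ℝ (Fin d))}
    {W : Fin n → Set (EuclideanSpace ℝ (Fin d))} (hV : IsConvexPartition V)
    (hW : IsConvexPartition W) {i : Fin (n + 1)} (hVW : ∀ j, V (i.succAbove j) ⊆ W j)
    (hB : Convex ℝ B) (hBi : (interior B).Nonempty)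
    (hi : Disjoint (interior (V i)) (interior U)) (j : Fin n) :
    relativeInradius B (U ∩ W j) ≤ relativeInradius B (U ∩ V (i.succAbove j)) := by
  refine relativeInradius_le_of_forall_pos fun r hr x hx => ?_
  obtain ⟨hxU, hxW⟩ := subset_inter_iff.mp hx
  have hcopy : Convex ℝ (x +ᵥ r • B) := (hB.smul r).vadd x
  have hcopy_int : (interior (x +ᵥ r • B)).Nonempty := by
    rw [interior_vadd, interior_smul₀ hr.ne']
    exact hBi.smul_set.vadd_set
  refine subset_inter hxU <|
    subset_of_convex_of_interior_subset hcopy hcopy_int (hV.isClosed _) <|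
      hV.subset_of_forall_disjoint_interior isOpen_interior fun k hk => ?_
  rcases Fin.eq_self_or_eq_succAbove i k with rfl | ⟨l, rfl⟩
  · exact hi.mono_right (interior_mono hxU)
  · have hlj : l ≠ j := fun h => hk (h ▸ rfl)
    exact (hW.interior_disjoint l j hlj).mono (interior_mono (hVW l)) (interior_mono hxW)

theorem le_sum_relativeInradius_of_forall_disjoint [Nontrivial (Fin n)] {c : ℝ}
    (hV : IsConvexPartition V) (hBc : IsCompact B) (hB : Convex ℝ B)
    (h : ∀ (y : EuclideanSpace ℝ (Fin d)) i, Disjoint (interior (V i)) (interior (y +ᵥ B)) →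
      c ≤ ∑ j, relativeInradius B ((y +ᵥ B) ∩ V j))
    (y : EuclideanSpace ℝ (Fin d)) : c ≤ ∑ j, relativeInradius B ((y +ᵥ B) ∩ V j) := by
  set D : Set (EuclideanSpace ℝ (Fin d)) := ⋂ i, (V i - B)
  have hD : IsClosed D := isClosed_iInter fun i => by
    simpa only [sub_eq_add_neg] using (hV.isClosed i).add_right_of_isCompact hBc.neg
  have hDne : D ≠ univ := fun hD' => by
    obtain ⟨i, j, hij⟩ := exists_pair_ne (Fin n)
    exact sub_ne_univ_of_convex_of_isCompact (hV.isClosed i) (hV.convex i) (hV.ne_univ hij) hBc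
      (iInter_eq_univ.mp hD' i)
  have hconc : ConcaveOn ℝ D fun y => ∑ j, relativeInradius B ((y +ᵥ B) ∩ V j) := by
    refine ⟨convex_iInter fun i => (hV.convex i).sub hB, fun p hp q hq s t hs ht hst => ?_⟩
    simp only [Finset.smul_sum, ← Finset.sum_add_distrib]
    exact Finset.sum_le_sum fun i _ => (concaveOn_relativeInradius_vadd_inter hB (hV.convex i)).2
      (mem_iInter.mp hp i) (mem_iInter.mp hq i) hs ht hst
  have hbdd : BddBelow ((fun y => ∑ j, relativeInradius B ((y +ᵥ B) ∩ V j)) '' D) :=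
    ⟨0, forall_mem_image.mpr fun _ _ => Finset.sum_nonneg fun _ _ => relativeInradius_nonneg⟩
  have houter : ∀ y ∉ interior D, c ≤ ∑ j, relativeInradius B ((y +ᵥ B) ∩ V j) := by
    intro y hy
    rw [interior_iInter_of_finite, mem_iInter, not_forall] at hy
    obtain ⟨i, hi⟩ := hy
    refine h y i ?_
    rw [interior_vadd, disjoint_comm, disjoint_iff_inter_eq_empty, ← not_nonempty_iff_eq_empty,
      vadd_inter_nonempty_iff']
    rintro ⟨v, b, ⟨hv, hb⟩, rfl⟩
    exact hi (subset_interior_sub (sub_mem_sub hv hb))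
  by_cases hy : y ∈ D
  · exact le_of_concaveOn_of_forall_mem_frontier
      (F := fun y => ∑ j, relativeInradius B ((y +ᵥ B) ∩ V j))
      hD hDne hconc hbdd (fun p hp => houter p hp.2) hy
  · exact houter y fun hyI => hy (interior_subset hyI)

end IsConvexPartition

namespace IsInductivePartition

theorem isConvexPartition (hV : IsInductivePartition V) : IsConvexPartition V := by
  match n, V, hV with
  | 1, V, hV =>
    have huniv : ∀ i, V i = univ := fun i => by rw [Subsingleton.elim i 0]; exact hV
    exact
      { isClosed := fun i => huniv i ▸ isClosed_univ
        convex := fun i => huniv i ▸ convex_univ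
        interior_nonempty := fun i => by rw [huniv, interior_univ]; exact univ_nonempty
        interior_disjoint := fun i j hij => absurd (Subsingleton.elim i j) hij
        iUnion_eq := eq_univ_of_subset (subset_iUnion V 0) hV }
  | _ + 2, _, hV => exact hV.1

theorem one_le_sum_relativeInradius (hV : IsInductivePartition V) (hBc : IsCompact B)
    (hB : Convex ℝ B) (hBi : (interior B).Nonempty) (y : EuclideanSpace ℝ (Fin d)) :
    1 ≤ ∑ i, relativeInradius B ((y +ᵥ B) ∩ V i) := by
  induction n generalizing y with
  | zero => exact hV.elim
  | succ n ih =>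
    cases n with
    | zero =>
      rw [Fin.sum_univ_one, show V 0 = univ from hV, inter_univ]
      exact le_relativeInradius (x := y) (right_mem_Icc.mpr zero_le_one) (by rw [one_smul])
    | succ n =>
      refine hV.isConvexPartition.le_sum_relativeInradius_of_forall_disjoint hBc hB
        (fun y i hi => ?_) y
      obtain ⟨W, hW, hVW⟩ := hV.2 i
      calc (1 : ℝ) ≤ ∑ j, relativeInradius B ((y +ᵥ B) ∩ W j) := ih hW y
        _ ≤ ∑ j, relativeInradius B ((y +ᵥ B) ∩ V (i.succAbove j)) :=
            Finset.sum_le_sum fun j _ => hV.isConvexPartition.relativeInradius_inter_le_of_disjoint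
              hW.isConvexPartition hVW hB hBi hi j
        _ ≤ ∑ k, relativeInradius B ((y +ᵥ B) ∩ V k) := by
            rw [Fin.sum_univ_succAbove _ i]
            exact le_add_of_nonneg_left relativeInradius_nonneg

end IsInductivePartition

end Partition

section Width

variable {d : ℕ} {A K : Set (EuclideanSpace ℝ (Fin d))}

theorem isBounded_inner_image (hA : IsBounded A) (u : EuclideanSpace ℝ (Fin d)) :
    IsBounded ((fun x => inner ℝ u x) '' A) :=
  (innerSL ℝ u).lipschitz.isBounded_image hA

theorem widthParallel_nonneg (hA : IsBounded A) (u : EuclideanSpace ℝ (Fin d)) :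
    0 ≤ widthParallel A u :=
  have hb := isBounded_inner_image hA u
  sub_nonneg.mpr (Real.sInf_le_sSup _ hb.bddBelow hb.bddAbove)

theorem widthParallel_mono (hK : K.Nonempty) (hA : IsBounded A) (h : K ⊆ A)
    (u : EuclideanSpace ℝ (Fin d)) : widthParallel K u ≤ widthParallel A u :=
  have hb := isBounded_inner_image hA u
  sub_le_sub (csSup_le_csSup hb.bddAbove (hK.image _) (image_mono h))
    (csInf_le_csInf hb.bddBelow (hK.image _) (image_mono h))

theorem widthParallel_vadd_smul (hKn : K.Nonempty) (hK : IsBounded K) {r : ℝ} (hr : 0 ≤ r)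
    (x u : EuclideanSpace ℝ (Fin d)) :
    widthParallel (x +ᵥ r • K) u = r * widthParallel K u := by
  have himage : (fun z => inner ℝ u z) '' (x +ᵥ r • K) =
      {inner ℝ u x} + r • ((fun z => inner ℝ u z) '' K : Set ℝ) := by
    simp only [← image_vadd, ← image_smul, image_image, singleton_add, vadd_eq_add,
      inner_add_right, inner_smul_right, smul_eq_mul]
  have hne : (r • ((fun z => inner ℝ u z) '' K : Set ℝ)).Nonempty := (hKn.image _).smul_set
  have hb : IsBounded (r • ((fun z => inner ℝ u z) '' K : Set ℝ)) :=
    (isBounded_inner_image hK u).smul₀ r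
  rw [widthParallel, widthParallel, himage,
    csSup_add (singleton_nonempty _) bddAbove_singleton hne hb.bddAbove,
    csInf_add (singleton_nonempty _) bddBelow_singleton hne hb.bddBelow,
    csSup_singleton, csInf_singleton, Real.sSup_smul_of_nonneg hr, Real.sInf_smul_of_nonneg hr,
    smul_eq_mul, smul_eq_mul]
  ring

theorem relativeInradius_mul_widthParallel_le (hKn : K.Nonempty) (hK : IsBounded K)
    (hAn : A.Nonempty) (hA : IsBounded A) (u : EuclideanSpace ℝ (Fin d)) :
    relativeInradius K A * widthParallel K u ≤ widthParallel A u := by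
  have hcopy : ∀ r ∈ homothetyRatios K A, r * widthParallel K u ≤ widthParallel A u := by
    rintro r ⟨hr, x, hx⟩
    rw [← widthParallel_vadd_smul hKn hK hr.1 x]
    exact widthParallel_mono hKn.smul_set.vadd_set hA hx u
  rcases (widthParallel_nonneg hK u).eq_or_lt with hzero | hpos
  · simpa only [← hzero, mul_zero] using widthParallel_nonneg hA u
  · rw [← le_div_iff₀ hpos]
    exact csSup_le (homothetyRatios_nonempty hAn) fun r hr => (le_div_iff₀ hpos).mpr (hcopy r hr)

theorem relativeInradius_mul_iInf_widthParallel_le (hKn : K.Nonempty) (hK : IsBounded K)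
    (hAn : A.Nonempty) (hA : IsBounded A) {S : Set (EuclideanSpace ℝ (Fin d))} (hS : S.Nonempty)
    {φ : EuclideanSpace ℝ (Fin d) → ℝ} (hφ : ∀ u ∈ S, 0 ≤ φ u) :
    relativeInradius K A * (⨅ u : S, φ u * widthParallel K u) ≤
      ⨅ u : S, φ u * widthParallel A u := by
  have : Nonempty S := hS.to_subtype
  have hbdd : BddBelow (range fun u : S => φ u * widthParallel K u) :=
    ⟨0, forall_mem_range.mpr fun u => mul_nonneg (hφ u u.2) (widthParallel_nonneg hK u)⟩
  refine le_ciInf fun u => ?_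
  calc relativeInradius K A * (⨅ u : S, φ u * widthParallel K u)
      ≤ relativeInradius K A * (φ u * widthParallel K u) :=
        mul_le_mul_of_nonneg_left (ciInf_le hbdd u) relativeInradius_nonneg
    _ = φ u * (relativeInradius K A * widthParallel K u) := mul_left_comm ..
    _ ≤ φ u * widthParallel A u :=
        mul_le_mul_of_nonneg_left (relativeInradius_mul_widthParallel_le hKn hK hAn hA u)
          (hφ u u.2)

end Width

/-- The weight `φ u` takes the place of the reciprocal of the width of `C` in direction `u`. -/
theorem corollary2p3_general {d n : ℕ} {K S : Set (EuclideanSpace ℝ (Fin d))}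
    (hKc : IsCompact K) (hK : Convex ℝ K) (hKi : (interior K).Nonempty) (hS : S.Nonempty)
    {φ : EuclideanSpace ℝ (Fin d) → ℝ} (hφ : ∀ u ∈ S, 0 ≤ φ u)
    {V : Fin n → Set (EuclideanSpace ℝ (Fin d))} (hV : IsInductivePartition V)
    (hVK : ∀ i, (V i ∩ K).Nonempty) :
    ⨅ u : S, φ u * widthParallel K u ≤ ∑ i, ⨅ u : S, φ u * widthParallel (V i ∩ K) u := by
  have hKn : K.Nonempty := hKi.mono interior_subset
  have hsum : 1 ≤ ∑ i, relativeInradius K (V i ∩ K) := by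
    simpa only [zero_vadd, inter_comm K] using hV.one_le_sum_relativeInradius hKc hK hKi 0
  calc ⨅ u : S, φ u * widthParallel K u
      ≤ (∑ i, relativeInradius K (V i ∩ K)) * ⨅ u : S, φ u * widthParallel K u :=
        le_mul_of_one_le_left (Real.iInf_nonneg fun u =>
          mul_nonneg (hφ u u.2) (widthParallel_nonneg hKc.isBounded u)) hsum
    _ = ∑ i, relativeInradius K (V i ∩ K) * ⨅ u : S, φ u * widthParallel K u := Finset.sum_mul ..
    _ ≤ ∑ i, ⨅ u : S, φ u * widthParallel (V i ∩ K) u :=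
        Finset.sum_le_sum fun i _ => relativeInradius_mul_iInf_widthParallel_le hKn hKc.isBounded
          (hVK i) (hKc.isBounded.subset inter_subset_right) hS hφ

theorem corollary2p3 {d : ℕ} (hd : 2 ≤ d) (K C : ConvexBody (EuclideanSpace ℝ (Fin d)))
    (hK : (interior (K : Set (EuclideanSpace ℝ (Fin d)))).Nonempty)
    (hC : (interior (C : Set (EuclideanSpace ℝ (Fin d)))).Nonempty)
    {n : ℕ} (V : Fin n → Set (EuclideanSpace ℝ (Fin d))) (hV : IsInductivePartition V)
    (hVK : ∀ i, (interior (V i ∩ (K : Set (EuclideanSpace ℝ (Fin d))))).Nonempty) :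
    minimalRelativeWidth (C : Set (EuclideanSpace ℝ (Fin d))) (K : Set (EuclideanSpace ℝ (Fin d))) ≤
      ∑ i, minimalRelativeWidth (C : Set (EuclideanSpace ℝ (Fin d)))
        (V i ∩ (K : Set (EuclideanSpace ℝ (Fin d)))) := by
  have : Nontrivial (Fin d) := Fin.nontrivial_iff_two_le.mpr hd
  simpa only [minimalRelativeWidth, div_eq_inv_mul] using
    corollary2p3_general K.isCompact K.convex hK (NormedSpace.sphere_nonempty.mpr zero_le_one)
      (fun u _ => inv_nonneg.mpr (widthParallel_nonneg C.isCompact.isBounded u)) hV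
      fun i => (hVK i).mono interior_subset
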